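/- Let $k$ be an algebraically closed field, $X$ a smooth projective connected curve over $k$ with canonical bundle $\omega_X$, $D\subset X$ a finite set of closed points (also regarded as a reduced divisor), and $r\ge 0$ an integer. For each $x\in D$ let $m^1(x),\dots,m^{\sigma_x}(x)$ be positive integers with sum $r$; call these data $P$. For $x\in D$ and $t\ge 1$ put $\mu_t(x)=\#\{\ell : m^\ell(x)\ge t\}$ (the conjugate of the partition of $r$ obtained by reordering the $m^\ell(x)$), and for $1\le j\le r$ let $\gamma_j(x)$ be the unique $l$ with $\sum_{t\le l-1}\mu_t(x)<j\le\sum_{t\le l}\mu_t(x)$. A parabolic Higgs bundle of type $P$ is a vector bundle $E$ of rank $r$ on $X$ with, for each $x\in D$, a filtration $E|_x=F^0(x)\supseteq F^1(x)\supseteq\cdots\supseteq F^{\sigma_x}(x)=0$ such that $\dim F^{i-1}(x)/F^i(x)=m^i(x)$, together with an $\mathcal O_X$-linear map $\theta:E\to E\otimes\omega_X(D)$ that takes $F^i(x)$ into $F^{i+1}(x)\otimes\omega_X(D)|_x$ for all $x\in D$ and $0\le i<\sigma_x$. (If $\theta$ is only required to take each $F^i(x)$ into $F^i(x)\otimes\omega_X(D)|_x$,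 the pair is called a weak parabolic Higgs bundle.) Put $a_j(\theta)=\operatorname{tr}(\wedge^j\theta)$, $h^W(E,\theta)=(a_1(\theta),\dots,a_r(\theta))$, and $$\mathcal H=\prod_{j=1}^r H^0\big(X,\omega_X(D)^{\otimes j}\big),\qquad \mathcal H_P=\prod_{j=1}^r H^0\Big(X,\ \omega_X^{\otimes j}\otimes\mathcal O_X\big(\textstyle\sum_{x\in D}(j-\gamma_j(x))\,x\big)\Big).$$ Theorem. One has $\mathcal H_P\subseteq\mathcal H$, and for every parabolic Higgs bundle $(E,\theta)$ of type $P$ and every $1\le j\le r$, $$a_j(\theta)\in H^0\Big(X,\ \omega_X^{\otimes j}\otimes\mathcal O_X\big(\textstyle\sum_{x\in D}(j-\gamma_j(x))\,x\big)\Big).$$ Equivalently, $h^W$ maps parabolic Higgs bundles of type $P$ into the linear subspace $\mathcal H_P$ of $\mathcal H$. -/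

import Mathlib

open AlgebraicGeometry CategoryTheory TopologicalSpace Opposite TensorProduct
open scoped AlgebraicGeometry

noncomputable section

universe u

namespace ParabolicHiggs

/-! ### Partitions -/

/-- The conjugate partition of the partition obtained by reordering the positive integers
`m 0, …, m (σ - 1)` from large to small: `μ_t = #{ℓ | t ≤ m ℓ}` (`t ≥ 1`).
The count does not depend on the order of the `m ℓ`. -/
def conjugatePartition {σ : ℕ} (m : Fin σ → ℕ) (t : ℕ) : ℕ :=
  (Finset.univ.filter fun l : Fin σ => t ≤ m l).card

/-- The level function `γ` of a partition: `γ_j` is the least `l` with `j ≤ μ_1 + ⋯ + μ_l`. -/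
def levelFunction {σ : ℕ} (m : Fin σ → ℕ) (j : ℕ) : ℕ :=
  sInf {l : ℕ | j ≤ ∑ t ∈ Finset.Icc 1 l, conjugatePartition m t}

/-- `μ` is again a partition of `∑ m`. -/
theorem exists_le_sum_conjugatePartition {σ : ℕ} (m : Fin σ → ℕ) :
    ∑ t ∈ Finset.Icc 1 (∑ l, m l), conjugatePartition m t = ∑ l, m l := by
  simp only [conjugatePartition, Finset.card_filter]
  rw [Finset.sum_comm]
  refine Finset.sum_congr rfl fun l _ => ?_
  rw [← Finset.card_filter]
  have : (Finset.Icc 1 (∑ l, m l)).filter (fun t => t ≤ m l) = Finset.Icc 1 (m l) := by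
    ext t
    have := Finset.single_le_sum (f := m) (fun i _ => Nat.zero_le _) (Finset.mem_univ l)
    simp only [Finset.mem_filter, Finset.mem_Icc]
    omega
  rw [this]
  simp

/-- The characterization of the level function: for `1 ≤ j ≤ ∑ m`,
`γ_j = l` if and only if `∑_{t ≤ l - 1} μ_t < j ≤ ∑_{t ≤ l} μ_t`. -/
theorem levelFunction_eq_iff {σ : ℕ} (m : Fin σ → ℕ) {j : ℕ} (hj : 1 ≤ j) (hj' : j ≤ ∑ l, m l)
    (l : ℕ) : levelFunction m j = l ↔
      ∑ t ∈ Finset.Icc 1 (l - 1), conjugatePartition m t < j ∧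
        j ≤ ∑ t ∈ Finset.Icc 1 l, conjugatePartition m t := by
  have hne : {l : ℕ | j ≤ ∑ t ∈ Finset.Icc 1 l, conjugatePartition m t}.Nonempty :=
    ⟨_, hj'.trans (exists_le_sum_conjugatePartition m).ge⟩
  have hmono : ∀ {a b : ℕ}, a ≤ b → ∑ t ∈ Finset.Icc 1 a, conjugatePartition m t ≤
      ∑ t ∈ Finset.Icc 1 b, conjugatePartition m t := fun h =>
    Finset.sum_le_sum_of_subset (Finset.Icc_subset_Icc le_rfl h)
  constructor
  · rintro rfl
    refine ⟨?_, Nat.sInf_mem hne⟩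
    by_contra! h
    have h0 := Nat.sInf_le (m := levelFunction m j - 1)
      (s := {l : ℕ | j ≤ ∑ t ∈ Finset.Icc 1 l, conjugatePartition m t}) h
    change levelFunction m j ≤ levelFunction m j - 1 at h0
    have h1 : levelFunction m j = 0 := by omega
    rw [h1] at h
    simp at h
    omega
  · rintro ⟨h1, h2⟩
    refine le_antisymm (Nat.sInf_le h2) ?_
    by_contra! h
    have h3 : j ≤ ∑ t ∈ Finset.Icc 1 (levelFunction m j), conjugatePartition m t := Nat.sInf_mem hne
    have h4 := hmono (show levelFunction m j ≤ l - 1 by omega)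
    omega

/-! ### The curve -/

/-- A smooth projective (connected, hence integral) curve over the field `k`.
For curves "projective" and "proper" agree. -/
structure SmoothProjectiveCurve (k : Type u) [Field k] where
  /-- the underlying scheme -/
  X : Scheme.{u}
  /-- the structure morphism -/
  hom : X ⟶ Spec (CommRingCat.of k)
  [isIntegral : IsIntegral X]
  [isProper : IsProper hom]
  [smooth : SmoothOfRelativeDimension 1 hom]

attribute [instance] SmoothProjectiveCurve.isIntegral SmoothProjectiveCurve.isProper
  SmoothProjectiveCurve.smooth

variable {k : Type u} [Field k] (C : SmoothProjectiveCurve k)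

namespace SmoothProjectiveCurve

/-- The generic point of the curve. -/
abbrev η : C.X := genericPoint C.X

/-- The function field `K` of the curve. -/
abbrev K : Type u := C.X.functionField

/-- The residue field at a point. -/
abbrev κ (x : C.X) : Type u := IsLocalRing.ResidueField (C.X.presheaf.stalk x)

/-- The function field is an extension of `k` through the structure morphism. -/
instance : Algebra k C.K :=
  ((C.X.presheaf.germ ⊤ C.η trivial).hom.comp
    (C.hom.appTop.hom.comp (Scheme.ΓSpecIso (CommRingCat.of k)).inv.hom)).toAlgebra

variable {C} in
theorem η_specializes (x : C.X) : C.η ⤳ x := (genericPoint_spec C.X).specializes trivial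

variable {C} in
theorem η_mem {U : C.X.Opens} {x : C.X} (hx : x ∈ U) : C.η ∈ U :=
  (η_specializes x).mem_open U.isOpen hx

/-- The local ring `𝒪_{X,x}`, as a subring of the function field (the canonical map from the stalk
`𝒪_{X,x}` to `K` is injective). -/
def localRing (x : C.X) : Subring C.K :=
  (algebraMap (C.X.presheaf.stalk x) C.K).range

/-- The maximal ideal of `𝒪_{X,x}`. -/
def maxIdeal (x : C.X) : Ideal (C.localRing x) :=
  (IsLocalRing.maximalIdeal (C.X.presheaf.stalk x)).map
    (algebraMap (C.X.presheaf.stalk x) C.K).rangeRestrict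

/-- The germ at the generic point of a regular function on an open set containing the point `x`. -/
def germη {U : C.X.Opens} (x : U) : Γ(C.X, U) →+* C.K :=
  (C.X.presheaf.germ U C.η (η_mem x.2)).hom

theorem germη_mem {U : C.X.Opens} (x : U) (f : Γ(C.X, U)) : C.germη x f ∈ C.localRing x :=
  ⟨C.X.presheaf.germ U x x.2 f, by
    rw [RingHom.algebraMap_toAlgebra]
    exact ConcreteCategory.congr_hom (C.X.presheaf.germ_stalkSpecializes x.2 (η_specializes _)) f⟩

theorem algebraMap_mem (x : C.X) (c : k) : algebraMap k C.K c ∈ C.localRing x :=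
  C.germη_mem (U := ⊤) ⟨x, trivial⟩ _

end SmoothProjectiveCurve

/-! ### Line bundles of differentials with poles, as lattices of rational sections -/

/-- For an ideal `I` of `R` and an `R`-submodule `L` of `M`, the submodule "`I ^ (-n) • L`" of `M`.
If `R` is a discrete valuation ring with maximal ideal `I` and `L` is a torsion-free module
of rank one, then this is the stalk `L(n·x)` of the twist of the line bundle `L` by `n` times
the point `x`. -/
def poleTwist {R M : Type*} [CommRing R] [AddCommGroup M] [Module R M]
    (I : Ideal R) (n : ℤ) (L : Submodule R M) : Submodule R M where
  carrier := {s | ∀ f ∈ I ^ n.toNat, f • s ∈ I ^ (-n).toNat • L}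
  add_mem' ha hb f hf := by rw [smul_add]; exact add_mem (ha f hf) (hb f hf)
  zero_mem' f _ := by rw [smul_zero]; exact zero_mem _
  smul_mem' c s hs f hf := by rw [smul_comm]; exact Submodule.smul_mem _ _ (hs f hf)

namespace SmoothProjectiveCurve

/-- The module `Ω_{K/k}` of rational differentials. -/
abbrev RatDiff : Type u := Ω[C.K⁄k]

/-- The stalk at `x` of the canonical bundle `ω_X`, as a lattice in `Ω_{K/k}`: the differentials
`∑ f_i dg_i` with `f_i, g_i ∈ 𝒪_{X,x}`, i.e. the image of `Ω_{𝒪_{X,x}/k}`. -/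
def omega (x : C.X) : Submodule (C.localRing x) C.RatDiff :=
  Submodule.span _ (Set.range fun f : C.localRing x => KaehlerDifferential.D k C.K f)

open Classical in
/-- The stalk at `x` of `ω_X(D)`, for a reduced divisor `D`: differentials that have at most a
simple pole at `x` if `x ∈ D`, and regular ones otherwise. -/
def omegaLog (D : Finset C.X) (x : C.X) : Submodule (C.localRing x) C.RatDiff :=
  poleTwist (C.maxIdeal x) (if x ∈ D then 1 else 0) (C.omega x)

/-- The symmetric algebra of the one-dimensional `K`-vector space `Ω_{K/k}`; its part of degree `j`
is the space `(Ω_{K/k})^{⊗ j}` of rational sections of `ω_X^{⊗ j}`. -/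
abbrev RatSym : Type u := SymmetricAlgebra C.K C.RatDiff

/-- For a lattice `L` in `Ω_{K/k}`, the lattice `L^{⊗ j}` in `(Ω_{K/k})^{⊗ j}`: the sums of products of
`j` elements of `L`. -/
def tensorPow (x : C.X) (L : Submodule (C.localRing x) C.RatDiff) (j : ℕ) :
    Submodule (C.localRing x) C.RatSym :=
  (L.map ((SymmetricAlgebra.ι C.K C.RatDiff).restrictScalars (C.localRing x))) ^ j

/-- The global sections of a line bundle given by its stalks `L x`, which are lattices in a space
of rational sections: the rational sections that lie in all stalks. -/
def globalSections (L : ∀ x : C.X, Submodule (C.localRing x) C.RatSym) :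
    Submodule k C.RatSym where
  carrier := {s | ∀ x, s ∈ L x}
  add_mem' ha hb x := add_mem (ha x) (hb x)
  zero_mem' _ := zero_mem _
  smul_mem' c s hs x := by
    rw [← algebraMap_smul C.K c s]
    exact Submodule.smul_mem _ (⟨_, C.algebraMap_mem x c⟩ : C.localRing x) (hs x)

/-- `H⁰(X, ω_X(D)^{⊗ j})`. -/
def H0OmegaLogPow (D : Finset C.X) (j : ℕ) : Submodule k C.RatSym :=
  C.globalSections fun x => C.tensorPow x (C.omegaLog D x) j

/-- `H⁰(X, ω_X^{⊗ j} ⊗ 𝒪_X(∑_x A(x)·x))`, for a divisor `A`. -/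
def H0OmegaPowTwist (j : ℕ) (A : C.X → ℤ) : Submodule k C.RatSym :=
  C.globalSections fun x => poleTwist (C.maxIdeal x) (A x) (C.tensorPow x (C.omega x) j)

end SmoothProjectiveCurve

/-! ### Vector bundles -/

variable {C}

/-- The stalk of a sheaf of modules is a module over the stalk of the structure sheaf. -/
instance stalkModule (E : C.X.Modules) (x : C.X) :
    Module (C.X.presheaf.stalk x) (E.presheaf.stalk x) :=
  PresheafOfModules.instModuleCarrierStalkCommRingCatCarrierAbPresheafOpensCarrier
    (R := C.X.presheaf) E.val x

theorem germ_smul (E : C.X.Modules) (x : C.X) (U : C.X.Opens) (hx : x ∈ U)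
    (f : Γ(C.X, U)) (s : Γ(E, U)) :
    E.presheaf.germ U x hx (f • s) =
      C.X.presheaf.germ U x hx f • E.presheaf.germ U x hx s :=
  PresheafOfModules.germ_smul (R := C.X.presheaf) E.val x U hx f s

/-- `E` is a vector bundle of rank `r`: near every point there is a local frame, i.e. there are
sections `e_1, …, e_r` whose restrictions to every smaller open set `V` form a basis of the module
of sections over `V`. -/
def IsVectorBundle (E : C.X.Modules) (r : ℕ) : Prop :=
  ∀ x : C.X, ∃ (U : C.X.Opens) (_ : x ∈ U) (e : Fin r → Γ(E, U)),
    ∀ (V : C.X.Opens) (hV : V ≤ U),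
      LinearIndependent Γ(C.X, V) (fun i => E.presheaf.map (homOfLE hV).op (e i)) ∧
      Submodule.span Γ(C.X, V) (Set.range fun i => E.presheaf.map (homOfLE hV).op (e i)) = ⊤

/-- The generic stalk `E_η` of `E`, a vector space over the function field `K`. -/
abbrev Gen (E : C.X.Modules) : Type u := E.presheaf.stalk C.η

/-- The map `E_x → E_η` from the stalk at a point to the generic stalk. -/
def toGen (E : C.X.Modules) (x : C.X) : E.presheaf.stalk x →+ Gen E :=
  (E.presheaf.stalkSpecializes (SmoothProjectiveCurve.η_specializes x)).hom

/-- The fibre `E|_x = κ(x) ⊗ E_x`. -/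
def Fibre (E : C.X.Modules) (x : C.X) : Type u :=
  C.κ x ⊗[C.X.presheaf.stalk x] E.presheaf.stalk x

instance (E : C.X.Modules) (x : C.X) : AddCommGroup (Fibre E x) :=
  inferInstanceAs (AddCommGroup (C.κ x ⊗[C.X.presheaf.stalk x] E.presheaf.stalk x))

instance (E : C.X.Modules) (x : C.X) : Module (C.κ x) (Fibre E x) :=
  inferInstanceAs (Module (C.κ x) (C.κ x ⊗[C.X.presheaf.stalk x] E.presheaf.stalk x))

/-- The value `1 ⊗ e` in the fibre of an element `e` of the stalk. -/
def value (E : C.X.Modules) (x : C.X) : E.presheaf.stalk x →+ Fibre E x :=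
  (TensorProduct.mk (C.X.presheaf.stalk x) (C.κ x) (E.presheaf.stalk x) 1).toAddMonoidHom

theorem value_smul (E : C.X.Modules) (x : C.X) (f : C.X.presheaf.stalk x)
    (e : E.presheaf.stalk x) :
    value E x (f • e) = IsLocalRing.residue (C.X.presheaf.stalk x) f • value E x e := by
  change (1 : C.κ x) ⊗ₜ[C.X.presheaf.stalk x] (f • e) =
    IsLocalRing.residue (C.X.presheaf.stalk x) f • ((1 : C.κ x) ⊗ₜ[C.X.presheaf.stalk x] e)
  rw [TensorProduct.tmul_smul, TensorProduct.smul_tmul', TensorProduct.smul_tmul', Algebra.smul_def]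
  rfl

/-- The submodule of those elements of the stalk `E_x` whose value in the fibre `E|_x` lies
in the given subspace `F`. -/
def liftToStalk (E : C.X.Modules) (x : C.X) (F : Submodule (C.κ x) (Fibre E x)) :
    Submodule (C.X.presheaf.stalk x) (E.presheaf.stalk x) where
  carrier := {e | value E x e ∈ F}
  add_mem' ha hb := by
    change value E x (_ + _) ∈ F
    rw [map_add]
    exact add_mem ha hb
  zero_mem' := by
    change value E x 0 ∈ F
    rw [map_zero]
    exact zero_mem _
  smul_mem' f e he := by
    change value E x (f • _) ∈ F
    rw [value_smul]
    exact Submodule.smul_mem _ _ he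

/-! ### The sheaf `E ⊗ ω_X(D)` -/

/-- The rational sections of `E ⊗ ω_X(D)`. -/
abbrev RatTwist (E : C.X.Modules) : Type u := Gen E ⊗[C.K] C.RatDiff

/-- For a submodule `M` of the stalk `E_x`, the image `M ⊗ ω_X(D)_x` in the space `E_η ⊗ Ω_{K/k}`. -/
def twistStalk (E : C.X.Modules) (D : Finset C.X) (x : C.X)
    (M : Submodule (C.X.presheaf.stalk x) (E.presheaf.stalk x)) :
    Submodule (C.localRing x) (RatTwist E) :=
  Submodule.span _ {w | ∃ v ∈ M, ∃ ω ∈ C.omegaLog D x, w = toGen E x v ⊗ₜ[C.K] ω}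

/-- The group of all functions on `U` with values in the rational sections of `E ⊗ ω_X(D)`. -/
def TwistFun (E : C.X.Modules) (U : C.X.Opens) : Type u := U → RatTwist E

instance (E : C.X.Modules) (U : C.X.Opens) : AddCommGroup (TwistFun E U) :=
  inferInstanceAs (AddCommGroup (U → RatTwist E))

instance (E : C.X.Modules) (U : C.X.Opens) : Module Γ(C.X, U) (TwistFun E U) :=
  @Pi.module U (fun _ => RatTwist E) Γ(C.X, U) _ _ fun x => Module.compHom _ (C.germη x)

theorem TwistFun.smul_apply (E : C.X.Modules) (U : C.X.Opens) (f : Γ(C.X, U)) (s : TwistFun E U)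
    (x : U) : (f • s) x = C.germη x f • s x := rfl

/-- The sections over `U` of `E ⊗ ω_X(D)`: the rational sections that belong to the stalk
`E_x ⊗ ω_X(D)_x` for every `x ∈ U`. (A rational section is regarded as a constant function on `U`,
so that there is only one section over the empty set.) -/
def twistSections (E : C.X.Modules) (D : Finset C.X) (U : C.X.Opens) :
    Submodule Γ(C.X, U) (TwistFun E U) where
  carrier := {s | (∀ x y : U, s x = s y) ∧ ∀ x : U, s x ∈ twistStalk E D x ⊤}
  add_mem' ha hb :=
    ⟨fun x y => congrArg₂ (· + ·) (ha.1 x y) (hb.1 x y), fun x => add_mem (ha.2 x) (hb.2 x)⟩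
  zero_mem' := ⟨fun _ _ => rfl, fun _ => zero_mem _⟩
  smul_mem' f s hs := by
    refine ⟨fun x y => ?_, fun x => ?_⟩
    · rw [TwistFun.smul_apply, TwistFun.smul_apply, hs.1 x y]; rfl
    · rw [TwistFun.smul_apply]
      exact Submodule.smul_mem _ (⟨_, C.germη_mem x f⟩ : C.localRing x) (hs.2 x)

/-- Restriction of sections of `E ⊗ ω_X(D)`. -/
def twistRes (E : C.X.Modules) (D : Finset C.X) {U V : C.X.Opens} (h : V ≤ U) :
    twistSections E D U →+ twistSections E D V where
  toFun s := ⟨fun x => s.1 ⟨x.1, h x.2⟩, fun x y => s.2.1 ⟨x.1, h x.2⟩ ⟨y.1, h y.2⟩,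
    fun x => s.2.2 ⟨x.1, h x.2⟩⟩
  map_zero' := Subtype.ext (funext fun _ => rfl)
  map_add' _ _ := Subtype.ext (funext fun _ => rfl)

/-- `E ⊗ ω_X(D)` as a presheaf of abelian groups. -/
def twistPresheaf (E : C.X.Modules) (D : Finset C.X) : TopCat.Presheaf Ab.{u} C.X where
  obj U := AddCommGrpCat.of (twistSections E D U.unop)
  map i := AddCommGrpCat.ofHom (twistRes E D (leOfHom i.unop))
  map_id _ := rfl
  map_comp _ _ := rfl

theorem twistPresheaf_isSheaf (E : C.X.Modules) (D : Finset C.X) : (twistPresheaf E D).IsSheaf := by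
  rw [TopCat.Presheaf.isSheaf_iff_isSheafUniqueGluing]
  intro ι U (sf : ∀ i, twistSections E D (U i)) hsf
  have key : ∀ (i j : ι) (x : U i) (y : U j), (sf i).1 x = (sf j).1 y := by
    intro i j x y
    have hi := SmoothProjectiveCurve.η_mem x.2
    have hj := SmoothProjectiveCurve.η_mem y.2
    have h : twistRes E D (inf_le_left : U i ⊓ U j ≤ U i) (sf i) =
        twistRes E D (inf_le_right : U i ⊓ U j ≤ U j) (sf j) := hsf i j
    have h' := congrFun (congrArg Subtype.val h) ⟨C.η, hi, hj⟩
    exact ((sf i).2.1 x ⟨C.η, hi⟩).trans (h'.trans ((sf j).2.1 ⟨C.η, hj⟩ y))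
  have cov : ∀ x : (iSup U : C.X.Opens), ∃ i, x.1 ∈ U i := fun x => Opens.mem_iSup.1 x.2
  choose c hc using cov
  let s : twistSections E D (iSup U) :=
    ⟨fun x => (sf (c x)).1 ⟨x.1, hc x⟩, fun x y => key _ _ ⟨x.1, hc x⟩ ⟨y.1, hc y⟩,
      fun x => (sf (c x)).2.2 ⟨x.1, hc x⟩⟩
  refine ⟨s, fun i => ?_, fun t ht => ?_⟩
  · exact Subtype.ext (funext fun x => key _ _ ⟨x.1, _⟩ x)
  · refine Subtype.ext (funext fun x => ?_)
    have h : twistRes E D (le_iSup U (c x)) t = sf (c x) := ht (c x)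
    exact congrFun (congrArg Subtype.val h) ⟨x.1, hc x⟩

instance (E : C.X.Modules) (D : Finset C.X) (U : (C.X.Opens)ᵒᵖ) :
    Module (C.X.ringCatSheaf.obj.obj U) ((twistPresheaf E D).obj U) :=
  inferInstanceAs (Module Γ(C.X, U.unop) (twistSections E D U.unop))

/-- The sheaf of modules `E ⊗ ω_X(D)`. -/
def twist (E : C.X.Modules) (D : Finset C.X) : C.X.Modules where
  val := PresheafOfModules.ofPresheaf (twistPresheaf E D) fun U V i f s => by
    refine Subtype.ext (funext fun x => ?_)
    have h : C.germη ⟨x.1, leOfHom i.unop x.2⟩ f = C.germη x (C.X.presheaf.map i f) :=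
      (C.X.presheaf.germ_res_apply i.unop C.η _ f).symm
    exact congrArg (· • (show twistSections E D U.unop from s).1 ⟨x.1, leOfHom i.unop x.2⟩) h
  isSheaf := twistPresheaf_isSheaf E D

/-- A section of `E ⊗ ω_X(D)` over `U`, evaluated at a point of `U`. -/
def twistEval (E : C.X.Modules) (D : Finset C.X) {U : C.X.Opens} (s : Γ(twist E D, U)) (x : U) :
    RatTwist E :=
  (show twistSections E D U from s).1 x

theorem twistEval_smul (E : C.X.Modules) (D : Finset C.X) {U : C.X.Opens} (f : Γ(C.X, U))
    (s : Γ(twist E D, U)) (x : U) :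
    twistEval E D (f • s) x = C.germη x f • twistEval E D s x := rfl

/-- The inclusion of the generic stalk of `E ⊗ ω_X(D)` in the space of rational sections. -/
def twistGen (E : C.X.Modules) (D : Finset C.X) :
    (twist E D).presheaf.stalk C.η ⟶ AddCommGrpCat.of (RatTwist E) :=
  Limits.colimit.desc ((OpenNhds.inclusion C.η).op ⋙ (twist E D).presheaf)
    { pt := AddCommGrpCat.of (RatTwist E)
      ι :=
        { app U := AddCommGrpCat.ofHom
            { toFun s := twistEval E D s ⟨C.η, U.unop.2⟩
              map_zero' := rfl
              map_add' _ _ := rfl }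
          naturality _ _ _ := rfl } }

theorem twistGen_germ (E : C.X.Modules) (D : Finset C.X) {U : C.X.Opens} (hU : C.η ∈ U)
    (s : Γ(twist E D, U)) :
    twistGen E D ((twist E D).presheaf.germ U C.η hU s) = twistEval E D s ⟨C.η, hU⟩ :=
  ConcreteCategory.congr_hom (Limits.colimit.ι_desc
    (F := (OpenNhds.inclusion C.η).op ⋙ (twist E D).presheaf) _ (op ⟨U, hU⟩)) s

/-- The additive map `E_η → E_η ⊗ Ω_{K/k}` induced by a morphism `θ : E → E ⊗ ω_X(D)`. -/
def genericAux {E : C.X.Modules} {D : Finset C.X} (θ : E ⟶ twist E D) : Gen E →+ RatTwist E :=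
  ((TopCat.Presheaf.stalkFunctor Ab C.η).map θ.mapPresheaf ≫ twistGen E D).hom

theorem genericAux_germ {E : C.X.Modules} {D : Finset C.X} (θ : E ⟶ twist E D) {U : C.X.Opens}
    (hU : C.η ∈ U) (s : Γ(E, U)) :
    genericAux θ (E.presheaf.germ U C.η hU s) = twistEval E D (θ.app U s) ⟨C.η, hU⟩ := by
  rw [← twistGen_germ]
  exact congrArg (twistGen E D)
    (TopCat.Presheaf.stalkFunctor_map_germ_apply U C.η hU θ.mapPresheaf s)

/-- The `K`-linear map `E_η → E_η ⊗ Ω_{K/k}` induced by a morphism `θ : E → E ⊗ ω_X(D)`. -/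
def generic {E : C.X.Modules} {D : Finset C.X} (θ : E ⟶ twist E D) :
    Gen E →ₗ[C.K] RatTwist E where
  toFun := genericAux θ
  map_add' := map_add _
  map_smul' a v := by
    obtain ⟨U, hU, f, rfl⟩ := C.X.presheaf.exists_germ_eq a
    obtain ⟨V, hV, s, rfl⟩ := E.presheaf.exists_germ_eq v
    have hW : C.η ∈ U ⊓ V := ⟨hU, hV⟩
    rw [← C.X.presheaf.germ_res_apply (homOfLE (inf_le_left : U ⊓ V ≤ U)) C.η hW f,
      ← E.presheaf.germ_res_apply (homOfLE (inf_le_right : U ⊓ V ≤ V)) C.η hW s,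
      ← germ_smul, genericAux_germ, genericAux_germ]
    exact (congrArg (twistEval E D · ⟨C.η, hW⟩) (Scheme.Modules.Hom.app_smul θ _ _)).trans
      (twistEval_smul E D _ _ _)

theorem generic_germ {E : C.X.Modules} {D : Finset C.X} (θ : E ⟶ twist E D) {U : C.X.Opens}
    (hU : C.η ∈ U) (s : Γ(E, U)) :
    generic θ (E.presheaf.germ U C.η hU s) = twistEval E D (θ.app U s) ⟨C.η, hU⟩ :=
  genericAux_germ θ hU s

/-! ### Characteristic coefficients -/

/-- Let `Sym` be the symmetric algebra of `Ω_{K/k}`. A `K`-linear map `φ : V → V ⊗ Ω_{K/k}` induces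
an endomorphism of the free `Sym`-module `Sym ⊗ V`. -/
def symExtension {V : Type u} [AddCommGroup V] [Module C.K V] (φ : V →ₗ[C.K] V ⊗[C.K] C.RatDiff) :
    C.RatSym ⊗[C.K] V →ₗ[C.RatSym] C.RatSym ⊗[C.K] V :=
  LinearMap.liftBaseChange C.RatSym
    ((TensorProduct.comm C.K V C.RatSym).toLinearMap ∘ₗ
      LinearMap.lTensor V (SymmetricAlgebra.ι C.K C.RatDiff) ∘ₗ φ)

/-- The characteristic coefficient `a_j(θ) = tr(⋀^j θ)` of a Higgs field `θ : E → E ⊗ ω_X(D)`,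
a rational section of `ω_X^{⊗ j}`. -/
def charCoeff {E : C.X.Modules} {D : Finset C.X} (θ : E ⟶ twist E D) (j : ℕ) : C.RatSym :=
  LinearMap.trace C.RatSym _ (exteriorPower.map j (symExtension (generic θ)))

/-! ### Parabolic Higgs bundles -/

/-- A quasi-parabolic structure of rank `r` on the curve: a finite set `D` of closed points, and for
every `x ∈ D` a sequence `m^1(x), …, m^{σ_x}(x)` of positive integers with sum `r` (indexed
from `0` here). -/
structure QuasiParabolicData (C : SmoothProjectiveCurve k) (r : ℕ) where
  /-- the finite set of marked points -/
  D : Finset C.X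
  isClosed : ∀ x ∈ D, IsClosed {x}
  /-- the length of the filtration at a marked point -/
  σ : D → ℕ
  /-- the Levi type at a marked point -/
  m : ∀ x : D, Fin (σ x) → ℕ
  m_pos : ∀ x i, 0 < m x i
  sum_m : ∀ x, ∑ i, m x i = r

variable {r : ℕ}

/-- A quasi-parabolic vector bundle of type `P`: a vector bundle `E` of rank `r` with, for every
`x ∈ D`, a filtration `E|_x = F^0(x) ⊇ F^1(x) ⊇ ⋯ ⊇ F^{σ_x}(x) = 0` whose graded pieces have the
dimensions prescribed by `P`. -/
structure QuasiParabolicBundle (P : QuasiParabolicData C r) where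
  /-- the underlying vector bundle -/
  E : C.X.Modules
  isVectorBundle : IsVectorBundle E r
  /-- the filtration of the fibre at a marked point -/
  F : ∀ x : P.D, Fin (P.σ x + 1) →
    Submodule (C.κ x.1) (Fibre E x.1)
  F_zero : ∀ x, F x 0 = ⊤
  F_last : ∀ x, F x (Fin.last _) = ⊥
  F_succ_le : ∀ x (i : Fin (P.σ x)), F x i.succ ≤ F x i.castSucc
  finrank_quotient : ∀ x (i : Fin (P.σ x)),
    Module.finrank (C.κ x.1)
      (F x i.castSucc ⧸ (F x i.succ).submoduleOf (F x i.castSucc)) = P.m x i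

/-- The map induced by `θ` on the fibres at `x` takes the subspace `F` of `E|_x` to
`F' ⊗ ω_X(D)|_x`: for a local section `s` of `E` with value in `F` at `x`, the germ of `θ(s)` at `x`
lies in the preimage `M' ⊗ ω_X(D)_x` of `F' ⊗ ω_X(D)|_x`, where `M'` is the preimage of `F'` in the
stalk `E_x`. -/
def TakesInto {E : C.X.Modules} {D : Finset C.X} (θ : E ⟶ twist E D) (x : C.X)
    (F F' : Submodule (C.κ x) (Fibre E x)) : Prop :=
  ∀ (U : C.X.Opens) (hx : x ∈ U) (s : Γ(E, U)),
    E.presheaf.germ U x hx s ∈ liftToStalk E x F →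
      twistEval E D (θ.app U s) ⟨x, hx⟩ ∈ twistStalk E D x (liftToStalk E x F')

/-- A weak parabolic Higgs bundle of type `P`: a quasi-parabolic bundle with a Higgs field
`θ : E → E ⊗ ω_X(D)` that takes each `F^i(x)` to `F^i(x) ⊗ ω_X(D)|_x`. -/
structure WeakParabolicHiggsBundle (P : QuasiParabolicData C r) extends QuasiParabolicBundle P where
  /-- the Higgs field -/
  θ : E ⟶ twist E P.D
  weak : ∀ (x : P.D) (i : Fin (P.σ x + 1)), TakesInto θ x.1 (F x i) (F x i)

/-- A weak parabolic Higgs bundle is a parabolic Higgs bundle if its Higgs field `θ` is strongly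
parabolic: it takes each `F^i(x)` to `F^{i+1}(x) ⊗ ω_X(D)|_x`. -/
def WeakParabolicHiggsBundle.IsParabolic {P : QuasiParabolicData C r}
    (H : WeakParabolicHiggsBundle P) : Prop :=
  ∀ (x : P.D) (i : Fin (P.σ x)), TakesInto H.θ x.1 (H.F x i.castSucc) (H.F x i.succ)

/-! ### The Hitchin bases and the Hitchin map -/

open Classical in
/-- The divisor `∑_{x ∈ D} (j - γ_j(x))·x`, where `γ(x)` is the level function of the Levi
type at `x`. -/
def QuasiParabolicData.divisor (P : QuasiParabolicData C r) (j : ℕ) (x : C.X) : ℤ :=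
  if h : x ∈ P.D then (j : ℤ) - (levelFunction (P.m ⟨x, h⟩) j : ℤ) else 0

/-- The Hitchin base `ℋ = ∏_{j = 1}^r H⁰(X, ω_X(D)^{⊗ j})`. -/
def hitchinBase (P : QuasiParabolicData C r) : Submodule k (Fin r → C.RatSym) :=
  Submodule.pi Set.univ fun j => C.H0OmegaLogPow P.D (j + 1)

/-- The parabolic Hitchin base
`ℋ_P = ∏_{j = 1}^r H⁰(X, ω_X^{⊗ j} ⊗ 𝒪_X(∑_{x ∈ D} (j - γ_j(x))·x))`. -/
def parabolicHitchinBase (P : QuasiParabolicData C r) : Submodule k (Fin r → C.RatSym) :=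
  Submodule.pi Set.univ fun j => C.H0OmegaPowTwist (j + 1) (P.divisor (j + 1))

/-- The weak parabolic Hitchin map `(E, θ) ↦ (a_1(θ), …, a_r(θ))`. -/
def hitchinMap (P : QuasiParabolicData C r) (H : WeakParabolicHiggsBundle P) : Fin r → C.RatSym :=
  fun j => charCoeff H.θ (j + 1)

end ParabolicHiggs

end

open AlgebraicGeometry CategoryTheory TopologicalSpace Opposite TensorProduct
open scoped AlgebraicGeometry

universe u

namespace ParabolicHiggs

/-! ### Local rings of smooth curves -/

section LocalRing

variable (R B A : Type*) [CommRing R] [CommRing B] [CommRing A] [IsLocalRing A]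
  [Algebra R B] [Algebra R A] [Algebra B A] [IsScalarTower R B A]

/-! All conditions are stalkwise, so fix a point `x`. In any basis of the generic stalk, `a_j(θ)` is
the sum of the principal `j × j` minors of the matrix of `θ`, hence a signed sum of products of `j`
entries (`trace_exteriorPower_map_mem`, `charCoeff_mem`). For `x ∉ D`, a local frame has entries in
`ω_x` and nothing more is needed.

For `x ∈ D`, lift a basis of `E|_x` adapted to the flag to a frame `e_p` of `E_x`, each `p` having a
level in the flag. Every entry has at most a simple pole. Strong parabolicity puts `θ(e_q)` one step
deeper than `q`, so its coordinates of level at most that of `q` have coefficients in the maximal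
ideal and the pole cancels. The pole order of a product indexed by `j` frame vectors and a
permutation is therefore at most the number of ascents, the factors whose row has larger level than
their column.

If `n` of the `j` vectors share a level, a permutation has at most `j - n` ascents
(`card_ascents_add_card_fiber_le`). For the largest such `n`, `j ≤ ∑ min(m^ℓ, n) = μ_1 + ⋯ + μ_n`,
so `γ_j ≤ n` and the pole order is at most `j - γ_j`.

The inclusion of the Hitchin bases follows from `0 ≤ j - γ_j ≤ j` and `ω^j(jx) = ω(x)^j`. Only here
is a uniformizer used; it comes from smoothness and algebraic closedness. -/

theorem isPrincipal_maximalIdeal_of_isStandardSmooth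
    [Algebra.IsStandardSmoothOfRelativeDimension 1 R B]
    (M : Submonoid B) [IsLocalization M A]
    (hbij : Function.Bijective (algebraMap R (IsLocalRing.ResidueField A))) :
    (IsLocalRing.maximalIdeal A).IsPrincipal ∧ IsLocalRing.maximalIdeal A ≠ ⊥ := by
  have hR : IsField R :=
    (RingEquiv.ofBijective _ hbij).toMulEquiv.isField (Field.toIsField _)
  let _ : Field R := hR.toField
  have hst : Algebra.IsStandardSmooth R B :=
    Algebra.IsStandardSmoothOfRelativeDimension.isStandardSmooth 1
  have hBn : IsNoetherianRing B := Algebra.FiniteType.isNoetherianRing R B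
  have hAn : IsNoetherianRing A := IsLocalization.isNoetherianRing M A hBn
  have hBnt : Nontrivial B := (algebraMap B A).domain_nontrivial
  have hsm : Algebra.FormallySmooth B A := Algebra.FormallySmooth.of_isLocalization M
  have hsm' : Algebra.FormallySmooth R A := Algebra.FormallySmooth.comp R B A
  have hκ : Algebra.FormallySmooth R (IsLocalRing.ResidueField A) :=
    Algebra.FormallySmooth.of_equiv
      (AlgEquiv.ofBijective (Algebra.ofId R (IsLocalRing.ResidueField A)) hbij)
  have hrank : Module.rank B Ω[B⁄R] = 1 := by
    simpa using Algebra.IsStandardSmoothOfRelativeDimension.rank_kaehlerDifferential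
      (R := R) (S := B) 1
  obtain ⟨b⟩ : Nonempty (Module.Basis Unit B Ω[B⁄R]) := by
    exact ⟨Module.basisUnique Unit (Module.finrank_eq_of_rank_eq (by simpa using hrank))⟩
  let bA : Module.Basis Unit A Ω[A⁄R] :=
    b.ofIsLocalizedModule A M (KaehlerDifferential.map R R B A)
  -- The residue field is `R` itself, hence formally smooth over `R`; this embeds the cotangent
  -- space of `A` in the fibre of `Ω[A⁄R]`, which has dimension one.
  have hinj := (Algebra.FormallySmooth.kerCotangentToTensor_injective_iff (R := R) (P := A)
    (A := IsLocalRing.ResidueField A) IsLocalRing.residue_surjective).2 inferInstance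
  constructor
  · rw [← IsLocalRing.finrank_cotangentSpace_le_one_iff]
    have hex : ∃ f : (RingHom.ker (algebraMap A (IsLocalRing.ResidueField A))).Cotangent →ₗ[A]
        IsLocalRing.ResidueField A ⊗[A] Ω[A⁄R], Function.Injective f := ⟨_, hinj⟩
    have hker : RingHom.ker (algebraMap A (IsLocalRing.ResidueField A)) =
      IsLocalRing.maximalIdeal A := IsLocalRing.ker_residue
    rw [hker] at hex
    obtain ⟨f, hf⟩ := hex
    let bκ := bA.baseChange (IsLocalRing.ResidueField A)
    have : Module.Finite (IsLocalRing.ResidueField A) (IsLocalRing.ResidueField A ⊗[A] Ω[A⁄R]) :=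
      .of_basis bκ
    have hsurj : Function.Surjective (algebraMap A (IsLocalRing.ResidueField A)) :=
      IsLocalRing.residue_surjective
    refine (LinearMap.finrank_le_finrank_of_injective
      (f := (f.extendScalarsOfSurjective hsurj :
        IsLocalRing.CotangentSpace A →ₗ[IsLocalRing.ResidueField A] _)) hf).trans ?_
    rw [Module.finrank_eq_card_basis bκ, Fintype.card_unit]
  -- If the maximal ideal vanished, `A` would equal its residue field, so `R → A` would be onto and
  -- `Ω[A⁄R] = 0`, contradicting rank one.
  · intro hbot
    have hAκ : Function.Injective (algebraMap A (IsLocalRing.ResidueField A)) := by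
      rw [RingHom.injective_iff_ker_eq_bot, ← hbot]
      exact IsLocalRing.ker_residue
    have hsurj : Function.Surjective (algebraMap R A) := fun a => by
      obtain ⟨c, hc⟩ := hbij.2 (algebraMap A _ a)
      exact ⟨c, hAκ (by rw [← hc, ← IsScalarTower.algebraMap_apply])⟩
    have := KaehlerDifferential.subsingleton_of_surjective R A hsurj
    exact bA.ne_zero () (Subsingleton.elim _ _)

end LocalRing


/-- The Nullstellensatz: a closed point has residue field `k`. The isomorphism `residueFieldIsoBase`
is read off on global sections. -/
theorem bijective_evaluation_of_isClosed {k : Type u} [Field k] [IsAlgClosed k] {X : Scheme.{u}}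
    (f : X ⟶ Spec (CommRingCat.of k)) [LocallyOfFiniteType f] (x : X) (hx : IsClosed {x}) :
    Function.Bijective (f.appTop ≫ X.Γevaluation x).hom := by
  have h := congrArg Scheme.Hom.appTop (SpecMap_residueFieldIsoBase_inv f x hx)
  have key : f.appTop ≫ X.Γevaluation x =
      (Scheme.ΓSpecIso _).hom ≫ (residueFieldIsoBase f x hx).inv := by
    rw [← Scheme.ΓSpecIso_naturality, h]
    rw [Scheme.Hom.comp_appTop, Scheme.fromSpecResidueField, Scheme.Hom.comp_appTop, Category.assoc,
      Category.assoc, Scheme.ΓSpecIso_naturality, Scheme.fromSpecStalk_appTop]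
    simp
    rfl
  rw [key]
  exact ConcreteCategory.bijective_of_isIso _

theorem isPrincipal_maximalIdeal_stalk {k : Type u} [Field k] [IsAlgClosed k]
    (C : SmoothProjectiveCurve k) (x : C.X) (hx : IsClosed {x}) :
    (IsLocalRing.maximalIdeal (C.X.presheaf.stalk x)).IsPrincipal ∧
      IsLocalRing.maximalIdeal (C.X.presheaf.stalk x) ≠ ⊥ := by
  obtain ⟨U, hU, V, hV, hxV, e, hs⟩ :=
    SmoothOfRelativeDimension.exists_isStandardSmoothOfRelativeDimension (n := 1) (f := C.hom) x
  -- `Spec k` has a single point.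
  obtain rfl : U = ⊤ := by
    ext y
    simpa [Subsingleton.elim y (C.hom x)] using e hxV
  have := hV.isLocalization_stalk ⟨x, hxV⟩
  let := (C.hom.appLE ⊤ V e).hom.toAlgebra
  let := C.X.presheaf.algebra_section_stalk ⟨x, hxV⟩
  let : Algebra Γ(Spec (CommRingCat.of k), ⊤) (C.X.presheaf.stalk x) :=
    ((C.hom.appLE ⊤ V e) ≫ C.X.presheaf.germ V x hxV).hom.toAlgebra
  have : IsScalarTower Γ(Spec (CommRingCat.of k), ⊤) Γ(C.X, V) (C.X.presheaf.stalk x) :=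
    .of_algebraMap_eq' rfl
  have : Algebra.IsStandardSmoothOfRelativeDimension 1 Γ(Spec (CommRingCat.of k), ⊤) Γ(C.X, V) := hs
  refine isPrincipal_maximalIdeal_of_isStandardSmooth Γ(Spec (CommRingCat.of k), ⊤) Γ(C.X, V)
    (C.X.presheaf.stalk x) (hV.primeIdealOf ⟨x, hxV⟩).asIdeal.primeCompl ?_
  have h : (C.hom.appLE ⊤ V e ≫ C.X.presheaf.germ V x hxV) ≫ C.X.residue x =
      C.hom.appTop ≫ C.X.Γevaluation x := by
    rw [Scheme.Hom.appLE, Category.assoc, Category.assoc, C.X.presheaf.germ_res_assoc]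
    rfl
  change Function.Bijective ((C.hom.appLE ⊤ V e ≫ C.X.presheaf.germ V x hxV) ≫ C.X.residue x).hom
  rw [h]
  exact bijective_evaluation_of_isClosed C.hom x hx


/-! ### Combinatorics of the level function -/

/-- Double counting: the part `m l` contributes to `μ_t` exactly for `t ≤ m l`. -/
theorem sum_Icc_conjugatePartition {σ : ℕ} (m : Fin σ → ℕ) (n : ℕ) :
    ∑ t ∈ Finset.Icc 1 n, conjugatePartition m t = ∑ l, min (m l) n := by
  simp only [conjugatePartition, Finset.card_filter]
  rw [Finset.sum_comm]
  refine Finset.sum_congr rfl fun l _ => ?_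
  rw [← Finset.card_filter]
  have : (Finset.Icc 1 n).filter (fun t => t ≤ m l) = Finset.Icc 1 (min (m l) n) := by
    ext t
    simp only [Finset.mem_filter, Finset.mem_Icc, le_min_iff]
    tauto
  rw [this, Nat.card_Icc, Nat.add_sub_cancel]

theorem levelFunction_le_of_le_sum_min {σ : ℕ} (m : Fin σ → ℕ) {j n : ℕ}
    (h : j ≤ ∑ l, min (m l) n) : levelFunction m j ≤ n :=
  Nat.sInf_le (by simpa [sum_Icc_conjugatePartition] using h)

theorem levelFunction_le {σ : ℕ} (m : Fin σ → ℕ) {j : ℕ} (hj : j ≤ ∑ l, m l) :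
    levelFunction m j ≤ j := by
  refine levelFunction_le_of_le_sum_min m ?_
  -- If no part exceeds `j`, truncating at `j` changes nothing; otherwise a single large part
  -- already contributes `j`.
  by_cases h : ∀ l, m l ≤ j
  · simpa only [min_eq_left (h _)] using hj
  · push Not at h
    obtain ⟨l, hl⟩ := h
    calc j = min (m l) j := (min_eq_right hl.le).symm
      _ ≤ _ := Finset.single_le_sum (f := fun l => min (m l) j) (fun _ _ => Nat.zero_le _)
        (Finset.mem_univ l)

/-- Between two elements of the same level, a permutation has to descend weakly. -/
theorem card_ascents_add_card_fiber_le {α β : Type*} [Fintype α] [LinearOrder β]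
    (lev : α → β) (τ : Equiv.Perm α) (c : β) :
    (Finset.univ.filter fun i => lev i < lev (τ i)).card +
      (Finset.univ.filter fun i => lev i = c).card ≤ Fintype.card α := by
  -- If `i` ascends from level at least `c`, then `τ i` lies above `c`. Summed over `i`, the two
  -- counts of elements above `c` cancel because `τ` is a bijection.
  have h : ∀ i, (if lev i < lev (τ i) then 1 else 0) + (if lev i = c then 1 else 0) +
      (if c < lev i then 1 else 0) ≤ 1 + (if c < lev (τ i) then 1 else 0) := by
    intro i
    split_ifs <;> first | omega | (exfalso; order)
  have h' := Finset.sum_le_sum fun i (_ : i ∈ Finset.univ) => h i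
  simp only [Finset.sum_add_distrib] at h'
  rw [Equiv.sum_comp τ fun i => if c < lev i then 1 else 0] at h'
  simp only [Finset.card_filter]
  simp only [Finset.sum_const, Finset.card_univ, smul_eq_mul, mul_one] at h'
  omega

theorem card_ascents_add_levelFunction_le {α : Type*} [Fintype α] {σ : ℕ} (m : Fin σ → ℕ)
    (lev : α → Fin σ) (hlev : ∀ c, (Finset.univ.filter fun i => lev i = c).card ≤ m c)
    (τ : Equiv.Perm α) :
    (Finset.univ.filter fun i => lev i < lev (τ i)).card + levelFunction m (Fintype.card α) ≤
      Fintype.card α := by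
  rcases isEmpty_or_nonempty α with hα | ⟨⟨a⟩⟩
  · have : levelFunction m (Fintype.card α) ≤ 0 :=
      levelFunction_le_of_le_sum_min m (by simp)
    simpa using this
  -- With `n` the size of the largest fibre of `lev`, each fibre has at most `min (m l) n` elements,
  -- so `n` bounds the level function.
  obtain ⟨c, -, hc⟩ := Finset.exists_max_image Finset.univ
    (fun c => (Finset.univ.filter fun i => lev i = c).card) ⟨lev a, Finset.mem_univ _⟩
  have h : levelFunction m (Fintype.card α) ≤ (Finset.univ.filter fun i => lev i = c).card := by
    refine levelFunction_le_of_le_sum_min m ?_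
    rw [← Finset.card_univ, Finset.card_eq_sum_card_fiberwise (f := lev) (t := Finset.univ)
      (fun _ _ => Finset.mem_coe.2 (Finset.mem_univ _))]
    exact Finset.sum_le_sum fun l hl => le_min (hlev l) (hc l hl)
  have := card_ascents_add_card_fiber_le lev τ c
  omega

/-! ### The trace on an exterior power -/

/-- In the induced basis of the exterior power the diagonal entries are principal minors. Their
Leibniz expansions have signs `±1`, so an additive subgroup `T` is enough. -/
theorem trace_exteriorPower_map_mem {R M ι : Type*} [CommRing R] [AddCommGroup M] [Module R M]
    [Finite ι] (b : Module.Basis ι R M) (f : M →ₗ[R] M) (j : ℕ) (T : AddSubgroup R)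
    (hT : ∀ (a : Fin j → ι), Function.Injective a → ∀ τ : Equiv.Perm (Fin j),
      ∏ i, b.repr (f (b (a i))) (a (τ i)) ∈ T) :
    LinearMap.trace R _ (exteriorPower.map j f) ∈ T := by
  classical
  let _ : LinearOrder ι := linearOrderOfSTO WellOrderingRel
  have := Fintype.ofFinite (Set.powersetCard ι j)
  rw [LinearMap.trace_eq_matrix_trace R (b.exteriorPower j)]
  refine sum_mem fun s _ => ?_
  rw [Matrix.diag_apply, LinearMap.toMatrix_apply, exteriorPower.basis_repr_apply,
    exteriorPower.basis_apply, exteriorPower.ιMulti_family, exteriorPower.map_apply_ιMulti,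
    exteriorPower.ιMultiDual_apply_ιMulti, ← Matrix.det_transpose, Matrix.det_apply]
  refine sum_mem fun τ _ => ?_
  have h := hT (Set.powersetCard.ofFinEmbEquiv.symm s)
    (Set.powersetCard.ofFinEmbEquiv.symm s).injective τ
  rcases Int.units_eq_one_or (Equiv.Perm.sign τ) with hs | hs
  · simpa [hs] using h
  · simpa [hs] using h

/-! ### Pole twists of powers of lattices -/

section PoleTwist

variable {R S : Type*} [CommRing R] [CommRing S] [Algebra R S]

theorem poleTwist_zero {M : Type*} [AddCommGroup M] [Module R M] (I : Ideal R)
    (L : Submodule R M) : poleTwist I 0 L = L := by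
  ext s
  constructor
  · intro h
    simpa using h 1 (by simp)
  · intro h f _
    simpa using L.smul_mem f h

theorem smul_poleTwist_one_le {M : Type*} [AddCommGroup M] [Module R M] (I : Ideal R)
    (L : Submodule R M) : I • poleTwist I 1 L ≤ L :=
  Submodule.smul_le.2 fun f hf s hs => by simpa using hs f (by simpa using hf)

theorem prod_mem_pow_card {α : Type*} (L : Submodule R S) (g : α → S) (A : Finset α)
    (hA : ∀ i ∈ A, g i ∈ L) : ∏ i ∈ A, g i ∈ L ^ A.card := by
  classical
  induction A using Finset.induction_on with
  | empty => exact Submodule.one_le.1 le_rfl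
  | insert a A ha ih =>
    rw [Finset.prod_insert ha, Finset.card_insert_of_notMem ha, pow_succ']
    exact Submodule.mul_mem_mul (hA a (Finset.mem_insert_self a A))
      (ih fun i hi => hA i (Finset.mem_insert_of_mem hi))

/-- Each factor in `A` absorbs one factor of `I`: `I ^ n ⊆ I ^ |A|` and `I ^ |A| • L' ^ |A| = (I •
L') ^ |A| ≤ L ^ |A|`. The ideal need not be principal. -/
theorem prod_mem_poleTwist_pow {α : Type*} [Fintype α] (I : Ideal R) {L L' : Submodule R S}
    (hI : I • L' ≤ L) (g : α → S) (A : Finset α) (hA : ∀ i ∈ A, g i ∈ L')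
    (hA' : ∀ i ∉ A, g i ∈ L) {n : ℤ} (hn : (A.card : ℤ) ≤ n) :
    ∏ i, g i ∈ poleTwist I n (L ^ Fintype.card α) := by
  classical
  intro f hf
  have h0 : (-n).toNat = 0 := by omega
  rw [h0, pow_zero, Ideal.one_eq_top, Submodule.top_smul, ← Finset.prod_mul_prod_compl A,
    ← Finset.card_add_card_compl A, pow_add, ← smul_mul_assoc]
  refine Submodule.mul_mem_mul ?_ ?_
  · refine pow_le_pow_left' hI A.card ?_
    rw [smul_pow]
    exact Submodule.smul_mem_smul (Ideal.pow_le_pow_right (by omega) hf)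
      (prod_mem_pow_card L' g A hA)
  · exact prod_mem_pow_card L g Aᶜ fun i hi => hA' i (by simpa using hi)

/-- If `u` is an inverse of a uniformizer `t`, then multiplication by `u ^ j` is the passage from
`L ^ j` to `L(x) ^ j`. -/
theorem poleTwist_pow_le {K : Type*} [Field K] [Algebra R K] [Algebra K S] [IsScalarTower R K S]
    (t : R) (ht : algebraMap R K t ≠ 0) {L L' : Submodule R S}
    (hL : ∀ s, t • s ∈ L → s ∈ L') {n : ℤ} {j : ℕ} (hn : 0 ≤ n) (hnj : n ≤ j) :
    poleTwist (Ideal.span {t}) n (L ^ j) ≤ L' ^ j := by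
  have key : ∀ (i : ℕ) (s : S), t ^ i • s ∈ L ^ i → s ∈ L' ^ i := by
    have hcancel : ∀ (i : ℕ) (s : S), (algebraMap R K t)⁻¹ ^ i • t ^ i • s = s := fun i s => by
      rw [← algebraMap_smul K (t ^ i) s, smul_smul, map_pow, ← mul_pow, inv_mul_cancel₀ ht,
        one_pow, one_smul]
    have hcancel' : ∀ s : S, t • (algebraMap R K t)⁻¹ • s = s := fun s => by
      rw [← algebraMap_smul K t, smul_smul, mul_inv_cancel₀ ht, one_smul]
    -- Distribute one factor `t⁻¹` to each of the `i` factors; `t⁻¹ • b` is in `L'` because `t`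
    -- brings it back to `b ∈ L`.
    have h : ∀ (i : ℕ) (s : S), s ∈ L ^ i → (algebraMap R K t)⁻¹ ^ i • s ∈ L' ^ i := by
      intro i
      induction i with
      | zero => simp
      | succ i ih =>
        intro s hs
        rw [pow_succ] at hs
        induction hs using Submodule.mul_induction_on' with
        | mem_mul_mem a ha b hb =>
          rw [pow_succ, pow_succ, ← smul_mul_smul_comm]
          exact Submodule.mul_mem_mul (ih a ha) (hL _ (by rwa [hcancel']))
        | add a _ b _ ha hb =>
          rw [smul_add]
          exact add_mem ha hb
    intro i s hs
    rw [← hcancel i s]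
    exact h i _ hs
  intro s hs
  refine key j s ?_
  have h := hs (t ^ n.toNat) (Ideal.pow_mem_pow (Ideal.mem_span_singleton_self t) _)
  have h0 : (-n).toNat = 0 := by omega
  rw [h0, pow_zero, Ideal.one_eq_top, Submodule.top_smul] at h
  -- Allowing the maximal pole order `j` only weakens the condition: multiply by the missing power
  -- of `t`.
  have hj : j = (j - n.toNat) + n.toNat := by omega
  have h' := (L ^ j).smul_mem (t ^ (j - n.toNat)) h
  rwa [smul_smul, ← pow_add, ← hj] at h'

end PoleTwist


/-! ### Bases adapted to a flag -/

/-- Lifts of bases of the graded pieces, taken together, span each step of the flag, by induction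
from the last step upwards. Their number is `dim V`, so they form a basis. -/
theorem exists_basis_of_flag {κ V : Type*} [Field κ] [AddCommGroup V] [Module κ V]
    [FiniteDimensional κ V] {σ : ℕ} (m : Fin σ → ℕ) (F : Fin (σ + 1) → Submodule κ V)
    (h_zero : F 0 = ⊤) (h_last : F (Fin.last σ) = ⊥)
    (h_le : ∀ i : Fin σ, F i.succ ≤ F i.castSucc)
    (h_finrank : ∀ i : Fin σ,
      Module.finrank κ (F i.castSucc ⧸ (F i.succ).submoduleOf (F i.castSucc)) = m i)
    (h_sum : ∑ i, m i = Module.finrank κ V) :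
    ∃ b : Module.Basis (Σ i, Fin (m i)) κ V,
      ∀ i : Fin (σ + 1), F i = Submodule.span κ (b '' {p | i ≤ p.1.castSucc}) := by
  let q i := Module.finBasisOfFinrankEq κ _ (h_finrank i)
  choose w hw using fun (i : Fin σ) (a : Fin (m i)) => Submodule.mkQ_surjective _ (q i a)
  let v : (Σ i, Fin (m i)) → V := fun p => (w p.1 p.2 : V)
  have hF : ∀ i : Fin (σ + 1), F i = Submodule.span κ (v '' {p | i ≤ p.1.castSucc}) := by
    intro i
    induction i using Fin.reverseInduction with
    | last =>
      rw [h_last, eq_comm, Submodule.span_eq_bot]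
      rintro _ ⟨p, hp, rfl⟩
      exact absurd hp (not_le.2 (Fin.castSucc_lt_last _))
    | cast i ih =>
      refine le_antisymm (fun x hx => ?_) (Submodule.span_le.2 ?_)
      · have h1 : Submodule.mkQ ((F i.succ).submoduleOf (F i.castSucc)) ⟨x, hx⟩ ∈
            (Submodule.span κ (Set.range (w i))).map (Submodule.mkQ _) := by
          rw [Submodule.map_span, ← Set.range_comp]
          have : (Submodule.mkQ ((F i.succ).submoduleOf (F i.castSucc))) ∘ w i = q i :=
            funext (hw i)
          rw [this, (q i).span_eq]
          trivial
        obtain ⟨y, hy, hyx⟩ := h1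
        have h2 : x - (y : V) ∈ F i.succ := by
          have := (Submodule.Quotient.eq _).1 hyx.symm
          exact this
        have h3 : (y : V) ∈ Submodule.span κ (v '' {p | i.castSucc ≤ p.1.castSucc}) := by
          have := Submodule.mem_map_of_mem (f := (F i.castSucc).subtype) hy
          rw [Submodule.map_span] at this
          refine Submodule.span_mono ?_ this
          rintro _ ⟨_, ⟨a, rfl⟩, rfl⟩
          exact ⟨⟨i, a⟩, le_refl i.castSucc, rfl⟩
        have h4 : x - (y : V) ∈ Submodule.span κ (v '' {p | i.castSucc ≤ p.1.castSucc}) := by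
          rw [ih] at h2
          refine Submodule.span_mono (Set.image_mono fun p hp => ?_) h2
          exact (Fin.castSucc_lt_succ).le.trans hp
        simpa using add_mem h4 h3
      · rintro _ ⟨⟨l, a⟩, hp, rfl⟩
        have hanti : Antitone F := Fin.antitone_iff_succ_le.2 h_le
        exact hanti hp (w l a).2
  have hspan : ⊤ ≤ Submodule.span κ (Set.range v) := by
    rw [← h_zero, hF 0]
    exact Submodule.span_mono (Set.image_subset_range _ _)
  refine ⟨basisOfTopLeSpanOfCardEqFinrank v hspan (by simp [h_sum]), fun i => ?_⟩
  rw [coe_basisOfTopLeSpanOfCardEqFinrank]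
  exact hF i

/-! ### Frames of vector bundles -/

variable {k : Type u} [Field k] {C : SmoothProjectiveCurve k}

/-- The sections `e` of `E` over `U` form a basis of the module of sections over every smaller
open set. -/
def IsFrame (E : C.X.Modules) {r : ℕ} (U : C.X.Opens) (e : Fin r → Γ(E, U)) : Prop :=
  ∀ (V : C.X.Opens) (hV : V ≤ U),
    LinearIndependent Γ(C.X, V) (fun i => E.presheaf.map (homOfLE hV).op (e i)) ∧
    Submodule.span Γ(C.X, V) (Set.range fun i => E.presheaf.map (homOfLE hV).op (e i)) = ⊤

theorem exists_germ_eq_of_finite {r : ℕ} (x : C.X) (U : C.X.Opens) (hx : x ∈ U)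
    (c : Fin r → C.X.presheaf.stalk x) :
    ∃ (V : C.X.Opens) (_ : V ≤ U) (hV : x ∈ V) (f : Fin r → Γ(C.X, V)),
      ∀ i, C.X.presheaf.germ V x hV (f i) = c i := by
  choose V hVU hV f hf using fun i => C.X.presheaf.exists_le_germ_eq (c i) hx
  -- Keeping `U` in the intersection gives a subset of `U` also when `r = 0`.
  have hmem : x ∈ U ⊓ Finset.univ.inf V := by
    refine ⟨hx, ?_⟩
    have : x ∈ ((Finset.univ.inf V : C.X.Opens) : Set C.X) := by
      rw [Opens.coe_finset_inf]
      simpa using hV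
    exact this
  have hle : ∀ i, U ⊓ Finset.univ.inf V ≤ V i := fun i =>
    inf_le_right.trans (Finset.inf_le (Finset.mem_univ i))
  exact ⟨_, inf_le_left, hmem, fun i => C.X.presheaf.map (homOfLE (hle i)).op (f i), fun i => by
    rw [← hf i]
    exact C.X.presheaf.germ_res_apply (homOfLE (hle i)) x hmem (f i)⟩

theorem germ_sum_smul (E : C.X.Modules) {r : ℕ} (x : C.X) (V : C.X.Opens) (hV : x ∈ V)
    (f : Fin r → Γ(C.X, V)) (s : Fin r → Γ(E, V)) :
    E.presheaf.germ V x hV (∑ i, f i • s i) =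
      ∑ i, C.X.presheaf.germ V x hV (f i) • E.presheaf.germ V x hV (s i) := by
  rw [map_sum]
  exact Finset.sum_congr rfl fun i _ => germ_smul E x V hV _ _

theorem IsFrame.span_germ {E : C.X.Modules} {r : ℕ} {U : C.X.Opens} {e : Fin r → Γ(E, U)}
    (he : IsFrame E U e) {x : C.X} (hx : x ∈ U) :
    Submodule.span (C.X.presheaf.stalk x) (Set.range fun i => E.presheaf.germ U x hx (e i)) = ⊤ := by
  rw [eq_top_iff]
  rintro v -
  obtain ⟨V, hVU, hV, s, rfl⟩ := E.presheaf.exists_le_germ_eq v hx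
  have hs : s ∈ Submodule.span Γ(C.X, V)
      (Set.range fun i => E.presheaf.map (homOfLE hVU).op (e i)) := by
    rw [(he V hVU).2]
    trivial
  obtain ⟨f, rfl⟩ := (Submodule.mem_span_range_iff_exists_fun _).1 hs
  rw [germ_sum_smul]
  refine sum_mem fun i _ => Submodule.smul_mem _ _ (Submodule.subset_span ⟨i, ?_⟩)
  exact (E.presheaf.germ_res_apply (homOfLE hVU) x hV (e i)).symm

/-- A relation between germs already holds on some smaller neighbourhood, where the frame is still
independent. -/
theorem IsFrame.linearIndependent_germ {E : C.X.Modules} {r : ℕ} {U : C.X.Opens}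
    {e : Fin r → Γ(E, U)} (he : IsFrame E U e) {x : C.X} (hx : x ∈ U) :
    LinearIndependent (C.X.presheaf.stalk x) (fun i => E.presheaf.germ U x hx (e i)) := by
  rw [Fintype.linearIndependent_iff]
  intro c hc
  obtain ⟨V, hVU, hV, f, hf⟩ := exists_germ_eq_of_finite x U hx c
  have h0 : E.presheaf.germ V x hV (∑ i, f i • E.presheaf.map (homOfLE hVU).op (e i)) =
      E.presheaf.germ V x hV 0 := by
    rw [germ_sum_smul, map_zero, ← hc]
    refine Finset.sum_congr rfl fun i _ => ?_
    rw [hf i]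
    exact congrArg _ (E.presheaf.germ_res_apply (homOfLE hVU) x hV (e i))
  obtain ⟨W, hW, i₁, i₂, h⟩ := E.presheaf.germ_eq x hV hV _ _ h0
  have hWU := (leOfHom i₁).trans hVU
  have hlin := Fintype.linearIndependent_iff.1 (he W hWU).1
    (fun i => C.X.presheaf.map i₁.op (f i)) (by
      rw [map_zero, map_sum] at h
      rw [← h]
      refine Finset.sum_congr rfl fun i _ => ?_
      have h2 : E.presheaf.map i₁.op (E.presheaf.map (homOfLE hVU).op (e i)) =
          E.presheaf.map (homOfLE hWU).op (e i) := by
        rw [← ConcreteCategory.comp_apply, ← E.presheaf.map_comp]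
        rfl
      rw [← h2]
      exact (Scheme.Modules.map_smul E i₁ (f i) (E.presheaf.map (homOfLE hVU).op (e i))).symm)
  intro i
  rw [← hf i, ← C.X.presheaf.germ_res_apply i₁ x hW (f i), hlin i, map_zero]

/-- A frame of `E` near `x` gives a basis of the stalk at `x`. -/
noncomputable def IsFrame.basis {E : C.X.Modules} {r : ℕ} {U : C.X.Opens}
    {e : Fin r → Γ(E, U)} (he : IsFrame E U e) {x : C.X} (hx : x ∈ U) :
    Module.Basis (Fin r) (C.X.presheaf.stalk x) (E.presheaf.stalk x) :=
  .mk (he.linearIndependent_germ hx) (he.span_germ hx).ge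

theorem toGen_germ (E : C.X.Modules) {U : C.X.Opens} {x : C.X} (hx : x ∈ U) (s : Γ(E, U)) :
    toGen E x (E.presheaf.germ U x hx s) =
      E.presheaf.germ U C.η (SmoothProjectiveCurve.η_mem hx) s :=
  ConcreteCategory.congr_hom
    (E.presheaf.germ_stalkSpecializes hx (SmoothProjectiveCurve.η_specializes x)) s

theorem algebraMap_germ {U : C.X.Opens} {x : C.X} (hx : x ∈ U) (f : Γ(C.X, U)) :
    algebraMap (C.X.presheaf.stalk x) C.K (C.X.presheaf.germ U x hx f) =
      C.X.presheaf.germ U C.η (SmoothProjectiveCurve.η_mem hx) f := by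
  rw [RingHom.algebraMap_toAlgebra]
  exact ConcreteCategory.congr_hom
    (C.X.presheaf.germ_stalkSpecializes hx (SmoothProjectiveCurve.η_specializes x)) f

theorem toGen_smul (E : C.X.Modules) (x : C.X) (c : C.X.presheaf.stalk x)
    (v : E.presheaf.stalk x) :
    toGen E x (c • v) = algebraMap (C.X.presheaf.stalk x) C.K c • toGen E x v := by
  obtain ⟨U, hU, f, rfl⟩ := C.X.presheaf.exists_germ_eq c
  obtain ⟨V, hVU, hV, s, rfl⟩ := E.presheaf.exists_le_germ_eq v hU
  rw [← C.X.presheaf.germ_res_apply (homOfLE hVU) x hV f, ← germ_smul, toGen_germ, toGen_germ,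
    algebraMap_germ, germ_smul]

theorem finrank_gen {E : C.X.Modules} {r : ℕ} (hE : IsVectorBundle E r) :
    Module.finrank C.K (Gen E) = r := by
  obtain ⟨U, hU, e, he⟩ := hE C.η
  rw [Module.finrank_eq_card_basis (IsFrame.basis he hU), Fintype.card_fin]

theorem finite_stalk {E : C.X.Modules} {r : ℕ} (hE : IsVectorBundle E r) (x : C.X) :
    Module.Finite (C.X.presheaf.stalk x) (E.presheaf.stalk x) := by
  obtain ⟨U, hU, e, he⟩ := hE x
  exact .of_basis (IsFrame.basis he hU)

theorem finite_fibre {E : C.X.Modules} {r : ℕ} (hE : IsVectorBundle E r) (x : C.X) :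
    Module.Finite (C.κ x) (Fibre E x) := by
  obtain ⟨U, hU, e, he⟩ := hE x
  exact .of_basis ((IsFrame.basis he hU).baseChange (C.κ x))

theorem finrank_fibre {E : C.X.Modules} {r : ℕ} (hE : IsVectorBundle E r) (x : C.X) :
    Module.finrank (C.κ x) (Fibre E x) = r := by
  obtain ⟨U, hU, e, he⟩ := hE x
  exact (Module.finrank_eq_card_basis ((IsFrame.basis he hU).baseChange (C.κ x))).trans
    (Fintype.card_fin r)

/-- A generating family of `r` elements of the stalk at `x` of a vector bundle of rank `r` is a
basis of the generic stalk. -/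
theorem exists_basis_gen {E : C.X.Modules} {r : ℕ} (hE : IsVectorBundle E r) (x : C.X)
    {ι : Type*} [Fintype ι] (hι : Fintype.card ι = r) (e : ι → E.presheaf.stalk x)
    (he : Submodule.span (C.X.presheaf.stalk x) (Set.range e) = ⊤) :
    ∃ b : Module.Basis ι C.K (Gen E), ∀ i, b i = toGen E x (e i) := by
  have hspan : ⊤ ≤ Submodule.span C.K (Set.range fun i => toGen E x (e i)) := by
    have h1 : ∀ v : E.presheaf.stalk x,
        toGen E x v ∈ Submodule.span C.K (Set.range fun i => toGen E x (e i)) := by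
      intro v
      obtain ⟨c, rfl⟩ := (Submodule.mem_span_range_iff_exists_fun (C.X.presheaf.stalk x)).1
        (he ▸ Submodule.mem_top : v ∈ Submodule.span _ (Set.range e))
      rw [map_sum]
      refine sum_mem fun i _ => ?_
      rw [toGen_smul]
      exact Submodule.smul_mem _ _ (Submodule.subset_span ⟨i, rfl⟩)
    -- A frame near `x` also spans the generic stalk, and its generic germs come from `E_x`.
    obtain ⟨U, hU, f, hf⟩ := hE x
    refine (IsFrame.span_germ hf (SmoothProjectiveCurve.η_mem hU)).ge.trans
      (Submodule.span_le.2 ?_)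
    rintro _ ⟨i, rfl⟩
    have := h1 (E.presheaf.germ U x hU (f i))
    rwa [toGen_germ] at this
  refine ⟨basisOfTopLeSpanOfCardEqFinrank _ hspan (by rw [finrank_gen hE, hι]), fun i => ?_⟩
  rw [coe_basisOfTopLeSpanOfCardEqFinrank]

/-- At a marked point there is a frame of the stalk that is adapted to the filtration
of the fibre. -/
theorem QuasiParabolicBundle.exists_adapted_frame {r : ℕ} {P : QuasiParabolicData C r}
    (H : QuasiParabolicBundle P) (x : P.D) :
    ∃ e : (Σ i, Fin (P.m x i)) → H.E.presheaf.stalk x.1,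
      Submodule.span (C.X.presheaf.stalk x.1) (Set.range e) = ⊤ ∧
      (∀ p, e p ∈ liftToStalk H.E x.1 (H.F x p.1.castSucc)) ∧
      ∀ (i : Fin (P.σ x + 1)) (c : (Σ i, Fin (P.m x i)) → C.X.presheaf.stalk x.1),
        ∑ p, c p • e p ∈ liftToStalk H.E x.1 (H.F x i) →
        ∀ p, p.1.castSucc < i → c p ∈ IsLocalRing.maximalIdeal (C.X.presheaf.stalk x.1) := by
  have := finite_stalk H.isVectorBundle x.1
  have := finite_fibre H.isVectorBundle x.1
  obtain ⟨b, hb⟩ := exists_basis_of_flag (P.m x) (H.F x) (H.F_zero x) (H.F_last x)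
    (H.F_succ_le x) (H.finrank_quotient x) (by rw [P.sum_m, finrank_fibre H.isVectorBundle])
  have hsurj : Function.Surjective (value H.E x.1) :=
    TensorProduct.mk_surjective _ _ _ IsLocalRing.residue_surjective
  choose e he using fun p => hsurj (b p)
  -- Nakayama: lifts of a basis of the fibre generate the stalk.
  refine ⟨e, IsLocalRing.span_eq_top_of_tmul_eq_basis e b he, fun p => ?_, fun i c hc p hp => ?_⟩
  · change value H.E x.1 (e p) ∈ H.F x p.1.castSucc
    rw [he, hb]
    exact Submodule.subset_span ⟨p, le_refl p.1.castSucc, rfl⟩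
  · change value H.E x.1 (∑ p, c p • e p) ∈ H.F x i at hc
    rw [map_sum, hb] at hc
    simp only [value_smul, he] at hc
    rw [Module.Basis.mem_span_image] at hc
    rw [← IsLocalRing.residue_eq_zero_iff]
    -- The residues of `c` are the coordinates of the value in `b`, and a vector of `F x i` has no
    -- coordinates of level below `i`.
    by_contra h
    have hmem : p ∈ (b.repr (∑ p, IsLocalRing.residue _ (c p) • b p)).support := by
      rw [Finsupp.mem_support_iff, b.repr_sum_self]
      exact h
    exact absurd (hc hmem) (not_le.2 hp)


/-! ### Matrix entries of a Higgs field -/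

/-- The coordinates of an element of `V ⊗ Ω_{K/k}` with respect to a basis of `V`. -/
noncomputable def twistCoord {V ι : Type*} [AddCommGroup V] [Module C.K V]
    (b : Module.Basis ι C.K V) (p : ι) : V ⊗[C.K] C.RatDiff →ₗ[C.K] C.RatDiff :=
  (TensorProduct.lid C.K C.RatDiff).toLinearMap ∘ₗ LinearMap.rTensor C.RatDiff (b.coord p)

theorem twistCoord_tmul {V ι : Type*} [AddCommGroup V] [Module C.K V]
    (b : Module.Basis ι C.K V) (p : ι) (v : V) (ω : C.RatDiff) :
    twistCoord b p (v ⊗ₜ ω) = b.repr v p • ω := by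
  simp [twistCoord]

theorem repr_symExtension {V : Type u} {ι : Type*} [AddCommGroup V] [Module C.K V]
    (b : Module.Basis ι C.K V) (φ : V →ₗ[C.K] V ⊗[C.K] C.RatDiff) (p q : ι) :
    (b.baseChange C.RatSym).repr (symExtension φ (b.baseChange C.RatSym q)) p =
      SymmetricAlgebra.ι C.K C.RatDiff (twistCoord b p (φ (b q))) := by
  have key : ∀ w : V ⊗[C.K] C.RatDiff, (b.baseChange C.RatSym).repr
      (TensorProduct.comm C.K V C.RatSym
        (LinearMap.lTensor V (SymmetricAlgebra.ι C.K C.RatDiff) w)) p =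
      SymmetricAlgebra.ι C.K C.RatDiff (twistCoord b p w) := by
    intro w
    induction w with
    | zero => simp
    | tmul v ω => simp [twistCoord_tmul]
    | add w w' h h' => simp only [map_add, Finsupp.add_apply, h, h']
  rw [← key]
  simp [symExtension]

/-- Since `charCoeff` depends only on the generic map, the basis may be chosen anew at each point of
the curve. -/
theorem charCoeff_mem {E : C.X.Modules} {D : Finset C.X} (θ : E ⟶ twist E D) (j : ℕ)
    {ι : Type*} [Finite ι] (b : Module.Basis ι C.K (Gen E)) (T : AddSubgroup C.RatSym)
    (hT : ∀ (a : Fin j → ι), Function.Injective a → ∀ τ : Equiv.Perm (Fin j),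
      ∏ i, SymmetricAlgebra.ι C.K C.RatDiff (twistCoord b (a (τ i)) (generic θ (b (a i)))) ∈ T) :
    charCoeff θ j ∈ T := by
  refine trace_exteriorPower_map_mem (b.baseChange C.RatSym) _ j T fun a ha τ => ?_
  simp only [repr_symExtension]
  exact hT a ha τ

/-- Sections of the twist are constant functions, so evaluating at `x` or at `η` gives the same
rational section. -/
theorem generic_toGen {E : C.X.Modules} {D : Finset C.X} (θ : E ⟶ twist E D) {x : C.X}
    {U : C.X.Opens} (hx : x ∈ U) (s : Γ(E, U)) :
    generic θ (toGen E x (E.presheaf.germ U x hx s)) = twistEval E D (θ.app U s) ⟨x, hx⟩ := by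
  rw [toGen_germ, generic_germ]
  exact (show twistSections E D U from θ.app U s).2.1 _ _

theorem generic_toGen_mem {E : C.X.Modules} {D : Finset C.X} (θ : E ⟶ twist E D) (x : C.X)
    (v : E.presheaf.stalk x) : generic θ (toGen E x v) ∈ twistStalk E D x ⊤ := by
  obtain ⟨U, hU, s, rfl⟩ := E.presheaf.exists_germ_eq v
  rw [generic_toGen]
  exact (show twistSections E D U from θ.app U s).2.2 ⟨x, hU⟩

theorem TakesInto.generic_toGen_mem {E : C.X.Modules} {D : Finset C.X} {θ : E ⟶ twist E D}
    {x : C.X} {F F' : Submodule (C.κ x) (Fibre E x)} (h : TakesInto θ x F F')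
    {v : E.presheaf.stalk x} (hv : v ∈ liftToStalk E x F) :
    generic θ (toGen E x v) ∈ twistStalk E D x (liftToStalk E x F') := by
  obtain ⟨U, hU, s, rfl⟩ := E.presheaf.exists_germ_eq v
  rw [generic_toGen]
  exact h U hU s hv

theorem twistCoord_mem {E : C.X.Modules} {D : Finset C.X} {x : C.X} {ι : Type*}
    (b : Module.Basis ι C.K (Gen E)) (p : ι)
    {M : Submodule (C.X.presheaf.stalk x) (E.presheaf.stalk x)}
    {N : Submodule (C.localRing x) C.RatDiff}
    (h : ∀ v ∈ M, ∀ ω ∈ C.omegaLog D x, b.repr (toGen E x v) p • ω ∈ N)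
    {w : RatTwist E} (hw : w ∈ twistStalk E D x M) : twistCoord b p w ∈ N := by
  have : twistStalk E D x M ≤ N.comap ((twistCoord b p).restrictScalars (C.localRing x)) := by
    refine Submodule.span_le.2 ?_
    rintro _ ⟨v, hv, ω, hω, rfl⟩
    change twistCoord b p (toGen E x v ⊗ₜ ω) ∈ N
    rw [twistCoord_tmul]
    exact h v hv ω hω
  exact this hw

theorem exists_repr_toGen {E : C.X.Modules} {x : C.X} {ι : Type*} [Fintype ι]
    {e : ι → E.presheaf.stalk x}
    (he : Submodule.span (C.X.presheaf.stalk x) (Set.range e) = ⊤)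
    {b : Module.Basis ι C.K (Gen E)} (hb : ∀ i, b i = toGen E x (e i)) (v : E.presheaf.stalk x) :
    ∃ c : ι → C.X.presheaf.stalk x, ∑ i, c i • e i = v ∧
      ∀ i, b.repr (toGen E x v) i = algebraMap (C.X.presheaf.stalk x) C.K (c i) := by
  obtain ⟨c, rfl⟩ := (Submodule.mem_span_range_iff_exists_fun (C.X.presheaf.stalk x)).1
    (he ▸ Submodule.mem_top : v ∈ Submodule.span _ (Set.range e))
  refine ⟨c, rfl, fun i => ?_⟩
  rw [map_sum]
  simp only [toGen_smul, ← hb]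
  rw [b.repr_sum_self]

theorem twistCoord_generic_mem_omegaLog {E : C.X.Modules} {D : Finset C.X} (θ : E ⟶ twist E D)
    {x : C.X} {ι : Type*} [Fintype ι] {e : ι → E.presheaf.stalk x}
    (he : Submodule.span (C.X.presheaf.stalk x) (Set.range e) = ⊤)
    {b : Module.Basis ι C.K (Gen E)} (hb : ∀ i, b i = toGen E x (e i)) (p q : ι) :
    twistCoord b p (generic θ (b q)) ∈ C.omegaLog D x := by
  rw [hb q]
  refine twistCoord_mem b p (fun v _ ω hω => ?_) (generic_toGen_mem θ x (e q))
  obtain ⟨c, -, hc⟩ := exists_repr_toGen he hb v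
  rw [hc]
  exact Submodule.smul_mem _ (⟨_, c p, rfl⟩ : C.localRing x) hω

/-- The canonical map from the stalk at `x` to the local ring at `x` in the function field. -/
noncomputable def toLocalRing (C : SmoothProjectiveCurve k) (x : C.X) :
    C.X.presheaf.stalk x →+* C.localRing x :=
  (algebraMap (C.X.presheaf.stalk x) C.K).rangeRestrict

theorem maxIdeal_eq_map (x : C.X) : C.maxIdeal x =
    (IsLocalRing.maximalIdeal (C.X.presheaf.stalk x)).map (toLocalRing C x) := rfl

theorem smul_omegaLog_le {D : Finset C.X} {x : C.X} (hx : x ∈ D) :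
    C.maxIdeal x • C.omegaLog D x ≤ C.omega x := by
  rw [SmoothProjectiveCurve.omegaLog, if_pos hx]
  exact smul_poleTwist_one_le _ _

/-- A coefficient vanishing at `x` cancels the simple pole. -/
theorem smul_mem_omega {D : Finset C.X} {x : C.X} (hx : x ∈ D) {c : C.X.presheaf.stalk x}
    (hc : c ∈ IsLocalRing.maximalIdeal (C.X.presheaf.stalk x)) {ω : C.RatDiff}
    (hω : ω ∈ C.omegaLog D x) : algebraMap (C.X.presheaf.stalk x) C.K c • ω ∈ C.omega x := by
  have hc' : toLocalRing C x c ∈ C.maxIdeal x := Ideal.mem_map_of_mem (toLocalRing C x) hc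
  have h : toLocalRing C x c • ω ∈ C.omega x :=
    smul_omegaLog_le hx (Submodule.smul_mem_smul hc' hω)
  rw [← algebraMap_smul C.K (toLocalRing C x c) ω] at h
  exact h

theorem omegaLog_of_notMem {D : Finset C.X} {x : C.X} (hx : x ∉ D) :
    C.omegaLog D x = C.omega x := by
  rw [SmoothProjectiveCurve.omegaLog, if_neg hx, poleTwist_zero]

/-- The lattice in `Sym(Ω_{K/k})` given by a lattice of differentials. -/
noncomputable abbrev symLattice (x : C.X) (L : Submodule (C.localRing x) C.RatDiff) :
    Submodule (C.localRing x) C.RatSym :=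
  L.map ((SymmetricAlgebra.ι C.K C.RatDiff).restrictScalars (C.localRing x))

theorem smul_symLattice_omegaLog_le {D : Finset C.X} {x : C.X} (hx : x ∈ D) :
    C.maxIdeal x • symLattice x (C.omegaLog D x) ≤ symLattice x (C.omega x) := by
  rw [← Submodule.map_smul'']
  exact Submodule.map_mono (smul_omegaLog_le hx)

/-! ### The Hitchin bases -/

theorem charCoeff_mem_stalk_of_notMem {E : C.X.Modules} {D : Finset C.X} {r : ℕ}
    (hE : IsVectorBundle E r) (θ : E ⟶ twist E D) {x : C.X} (hx : x ∉ D) (j : ℕ) :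
    charCoeff θ j ∈ C.tensorPow x (C.omega x) j := by
  obtain ⟨U, hU, f, hf⟩ := hE x
  have he := IsFrame.span_germ hf hU
  obtain ⟨b, hb⟩ := exists_basis_gen hE x (Fintype.card_fin r) _ he
  refine charCoeff_mem θ j b (C.tensorPow x (C.omega x) j).toAddSubgroup fun a _ τ => ?_
  have h := prod_mem_pow_card (symLattice x (C.omega x)) (fun i =>
    SymmetricAlgebra.ι C.K C.RatDiff (twistCoord b (a (τ i)) (generic θ (b (a i)))))
    Finset.univ fun i _ => by
      refine Submodule.mem_map_of_mem ?_
      rw [← omegaLog_of_notMem hx]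
      exact twistCoord_generic_mem_omegaLog θ he hb _ _
  rw [Finset.card_univ, Fintype.card_fin] at h
  exact h

theorem WeakParabolicHiggsBundle.IsParabolic.charCoeff_mem_stalk {r : ℕ}
    {P : QuasiParabolicData C r} {H : WeakParabolicHiggsBundle P} (hH : H.IsParabolic)
    (x : P.D) (j : ℕ) :
    charCoeff H.θ j ∈ poleTwist (C.maxIdeal x.1) ((j : ℤ) - levelFunction (P.m x) j)
      (C.tensorPow x.1 (C.omega x.1) j) := by
  obtain ⟨e, he, heF, hF⟩ := H.exists_adapted_frame x
  obtain ⟨b, hb⟩ := exists_basis_gen H.isVectorBundle x.1 (by simp [P.sum_m]) e he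
  refine charCoeff_mem H.θ j b (poleTwist (C.maxIdeal x.1) _
    (C.tensorPow x.1 (C.omega x.1) j)).toAddSubgroup fun a ha τ => ?_
  -- As `a` is injective, at most `m c` of the chosen frame vectors have level `c`.
  have hcount := card_ascents_add_levelFunction_le (P.m x) (fun i => (a i).1) (fun c => by
    have hcard : (Finset.univ.map (Function.Embedding.sigmaMk (β := fun c => Fin (P.m x c)) c)).card =
        P.m x c := by
      rw [Finset.card_map, Finset.card_univ, Fintype.card_fin]
    refine le_trans (le_of_eq (Finset.card_map ⟨a, ha⟩).symm)
      (le_trans (Finset.card_le_card fun p hp => ?_) hcard.le)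
    obtain ⟨i, hi, rfl⟩ := Finset.mem_map.1 hp
    have hi' := (Finset.mem_filter.1 hi).2
    subst hi'
    exact Finset.mem_map.2 ⟨(a i).2, Finset.mem_univ _, rfl⟩) τ
  rw [Fintype.card_fin] at hcount
  have h := prod_mem_poleTwist_pow (C.maxIdeal x.1) (smul_symLattice_omegaLog_le x.2)
    (fun i => SymmetricAlgebra.ι C.K C.RatDiff (twistCoord b (a (τ i)) (generic H.θ (b (a i)))))
    -- Only the ascents are charged with a simple pole.
    (Finset.univ.filter fun i => (a i).1 < (a (τ i)).1)
    (fun i _ => Submodule.mem_map_of_mem (twistCoord_generic_mem_omegaLog H.θ he hb _ _))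
    (fun i hi => Submodule.mem_map_of_mem ?_)
    (n := (j : ℤ) - levelFunction (P.m x) j) (by omega)
  · rw [Fintype.card_fin] at h
    exact h
  · have hi' : (a (τ i)).1 ≤ (a i).1 := by simpa using hi
    rw [hb (a i)]
    refine twistCoord_mem b _ (fun v hv ω hω => ?_)
      ((hH x (a i).1).generic_toGen_mem (heF (a i)))
    obtain ⟨c, rfl, hc⟩ := exists_repr_toGen he hb v
    rw [hc]
    -- Strong parabolicity lands in step `(a i).1 + 1`, so even coordinates of the same level as `a
    -- i` have coefficients in the maximal ideal.
    have hm := hF _ c hv (a (τ i)) (Fin.castSucc_lt_succ_iff.2 hi')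
    exact smul_mem_omega x.2 hm hω

theorem WeakParabolicHiggsBundle.IsParabolic.charCoeff_mem {r : ℕ}
    {P : QuasiParabolicData C r} {H : WeakParabolicHiggsBundle P} (hH : H.IsParabolic) (j : ℕ) :
    charCoeff H.θ j ∈ C.H0OmegaPowTwist j (P.divisor j) := by
  intro x
  by_cases hx : x ∈ P.D
  · simp only [QuasiParabolicData.divisor, dif_pos hx]
    exact hH.charCoeff_mem_stalk ⟨x, hx⟩ j
  · simp only [QuasiParabolicData.divisor, dif_neg hx, poleTwist_zero]
    exact charCoeff_mem_stalk_of_notMem H.isVectorBundle H.θ hx j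

/-! ### Inclusion of the parabolic Hitchin base -/

theorem exists_maxIdeal_eq_span [IsAlgClosed k] {x : C.X} (hx : IsClosed {x}) :
    ∃ t : C.localRing x, (t : C.K) ≠ 0 ∧ C.maxIdeal x = Ideal.span {t} := by
  obtain ⟨⟨⟨s, hs⟩⟩, hne⟩ := isPrincipal_maximalIdeal_stalk C x hx
  have hs' : IsLocalRing.maximalIdeal (C.X.presheaf.stalk x) = Ideal.span {s} := hs
  refine ⟨toLocalRing C x s, fun h => hne ?_, ?_⟩
  · have h0 : s = 0 := (IsFractionRing.injective (C.X.presheaf.stalk x) C.K)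
      (by rw [map_zero]; exact h)
    rw [hs', h0, Ideal.span_singleton_eq_bot]
  · rw [maxIdeal_eq_map, hs', Ideal.map_span, Set.image_singleton]

theorem poleTwist_tensorPow_le [IsAlgClosed k] {D : Finset C.X} {x : C.X} (hx : IsClosed {x})
    (hxD : x ∈ D) {n : ℤ} {j : ℕ} (hn : 0 ≤ n) (hnj : n ≤ j) :
    poleTwist (C.maxIdeal x) n (C.tensorPow x (C.omega x) j) ≤
      C.tensorPow x (C.omegaLog D x) j := by
  obtain ⟨t, ht, hspan⟩ := exists_maxIdeal_eq_span hx
  -- With the maximal ideal generated by `t`, the simple pole condition need only be tested on `t`.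
  have hmem : ∀ ω : C.RatDiff, t • ω ∈ C.omega x → ω ∈ C.omegaLog D x := by
    intro ω hω
    rw [SmoothProjectiveCurve.omegaLog, if_pos hxD, hspan]
    intro f hf
    obtain ⟨g, rfl⟩ := Ideal.mem_span_singleton'.1 (by simpa using hf : f ∈ Ideal.span {t})
    rw [mul_smul]
    simpa using (C.omega x).smul_mem g hω
  rw [hspan]
  refine poleTwist_pow_le (K := C.K) t ht ?_ hn hnj
  -- If `t • s` is the image of `ω`, then `s` is the image of `t⁻¹ • ω`, because `ι` is `K`-linear.
  rintro s ⟨ω, hω, hs⟩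
  refine ⟨(t : C.K)⁻¹ • ω, hmem _ ?_, ?_⟩
  · have : t • (t : C.K)⁻¹ • ω = ω := by
      rw [← algebraMap_smul C.K t]
      change (t : C.K) • (t : C.K)⁻¹ • ω = ω
      rw [smul_smul, mul_inv_cancel₀ ht, one_smul]
    rwa [this]
  · change SymmetricAlgebra.ι C.K C.RatDiff ((t : C.K)⁻¹ • ω) = s
    replace hs : SymmetricAlgebra.ι C.K C.RatDiff ω = t • s := hs
    rw [map_smul, hs, ← algebraMap_smul C.K t]
    change (t : C.K)⁻¹ • (t : C.K) • s = s
    rw [smul_smul, inv_mul_cancel₀ ht, one_smul]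

theorem H0OmegaPowTwist_divisor_le [IsAlgClosed k] {r : ℕ} (P : QuasiParabolicData C r) {j : ℕ}
    (hj : j ≤ r) : C.H0OmegaPowTwist j (P.divisor j) ≤ C.H0OmegaLogPow P.D j := by
  intro s hs x
  have h := hs x
  by_cases hx : x ∈ P.D
  · simp only [QuasiParabolicData.divisor, dif_pos hx] at h
    have hγ : levelFunction (P.m ⟨x, hx⟩) j ≤ j := levelFunction_le _ (by rwa [P.sum_m])
    exact poleTwist_tensorPow_le (P.isClosed x hx) hx (by omega) (by omega) h
  · simp only [QuasiParabolicData.divisor, dif_neg hx, poleTwist_zero] at h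
    change s ∈ C.tensorPow x (C.omegaLog P.D x) j
    rwa [omegaLog_of_notMem hx]

end ParabolicHiggs

theorem theorem3p2 {k : Type*} [Field k] [IsAlgClosed k] (C : ParabolicHiggs.SmoothProjectiveCurve k)
    (r : ℕ) (P : ParabolicHiggs.QuasiParabolicData C r) :
    (∀ H : ParabolicHiggs.WeakParabolicHiggsBundle P, H.IsParabolic →
      ∀ j : ℕ, 1 ≤ j → j ≤ r →
        ParabolicHiggs.charCoeff H.θ j ∈ C.H0OmegaPowTwist j (P.divisor j)) ∧
    ParabolicHiggs.parabolicHitchinBase P ≤ ParabolicHiggs.hitchinBase P ∧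
    Set.MapsTo (ParabolicHiggs.hitchinMap P) {H | H.IsParabolic}
      (ParabolicHiggs.parabolicHitchinBase P) :=
  ⟨fun _ hH j _ _ => hH.charCoeff_mem j,
    -- The index `j : Fin r` stands for degree `j + 1`, so `j.2` is the bound `j + 1 ≤ r`.
    fun _ hs j hj => ParabolicHiggs.H0OmegaPowTwist_divisor_le P j.2 (hs j hj),
    fun _ hH j _ => hH.charCoeff_mem (j + 1)⟩
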